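/- All graphs are finite and simple, and rooted graphs are allowed to be disconnected. For a graph $G$ let $A(G)$ be its adjacency matrix and $\phi^{G}(x)=\det(xI-A(G))$ its characteristic polynomial, and for a vertex $i$ of $G$ let $\alpha_i^{G}=\phi^{G}/\phi^{G\setminus i}$, a rational function in $x$ (its zeros and poles are those of its reduced form). Let $n\ge 2$, let $G_1,\dots,G_n$ be rooted graphs, and let $G$ be the rooted product of the path $P_n$ (with vertices $1,\dots,n$ in this order) with $G_1,\dots,G_n$, that is, the graph obtained by identifying the root of $G_i$ with the vertex $i$ of $P_n$ for each $i$; the root of $G_i$ is denoted by $i$ as well. Assume that the connected component of $G$ that contains the path is isomorphic neither to $P_2$ nor to $P_3$ (when $G$ is connected: that $G$ is neither $P_2$ nor $P_3$), and that 1. $\alpha_i^{G_i}=\alpha_{n+1-i}^{G_{n+1-i}}$ for all $i\in\{1,\dots,n\}$; 2. for every real $\theta$ with $\alpha_1^{G}(\theta)=0$ and every $i\in\{1,\dots,n\}$, $\theta$ is not a pole of $\alpha_i^{G_i}$. Then there are two distinct eigenvalues $\lambda$ and $\mu$ of $A(G)$, each of which has an eigenvector with a non-zero entry at the vertex $1$,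 such that $|\lambda-\mu|<\sqrt2$ if $n$ is odd, and $|\lambda-\mu|\le 1$ if $n$ is even. -/

import Mathlib

open scoped Matrix

/-- The characteristic polynomial `det (x I - A(G))` of a finite graph, over `ℝ`. -/
noncomputable def SimpleGraph.charPoly {V : Type*} [Fintype V] (G : SimpleGraph V) :
    Polynomial ℝ := by
  classical exact (G.adjMatrix ℝ).charpoly

/-- The rational function `φ^G / φ^{G \ i}` in one variable, where `G \ i` is obtained from `G` by
deleting the vertex `i`. -/
noncomputable def SimpleGraph.rootFunction {V : Type*} [Fintype V] (G : SimpleGraph V) (i : V) :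
    RatFunc ℝ := by
  classical exact
    algebraMap (Polynomial ℝ) (RatFunc ℝ) G.charPoly /
      algebraMap (Polynomial ℝ) (RatFunc ℝ) (G.induce ({i}ᶜ : Set V)).charPoly

/-- `θ` is a zero of the rational function `f`: a root of its numerator in lowest terms. -/
def RatFunc.IsZeroAt (f : RatFunc ℝ) (θ : ℝ) : Prop := f.num.IsRoot θ

/-- `θ` is a pole of the rational function `f`: a root of its denominator in lowest terms. -/
def RatFunc.IsPoleAt (f : RatFunc ℝ) (θ : ℝ) : Prop := f.denom.IsRoot θ

/-- The eigenvalue support of the vertex `i`: all `θ` such that the adjacency matrix of `G` has a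
`θ`-eigenvector with a nonzero entry at `i`. -/
def SimpleGraph.eigenvalueSupport {V : Type*} [Fintype V] (G : SimpleGraph V) (i : V) :
    Set ℝ := by
  classical exact {θ | ∃ v : V → ℝ, G.adjMatrix ℝ *ᵥ v = θ • v ∧ v i ≠ 0}

/-- The rooted product of `H` with the graphs `G i`, rooted at `r i`: the disjoint union of the
`G i`, together with an edge joining the roots `r i` and `r j` whenever `i`, `j` are adjacent
in `H`. -/
def SimpleGraph.rootedProduct {ι : Type*} (H : SimpleGraph ι) {V : ι → Type*}
    (G : ∀ i, SimpleGraph (V i)) (r : ∀ i, V i) : SimpleGraph (Σ i, V i) where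
  Adj x y :=
    (∃ i, ∃ a b : V i, (G i).Adj a b ∧ x = ⟨i, a⟩ ∧ y = ⟨i, b⟩) ∨
      (∃ i j, H.Adj i j ∧ x = ⟨i, r i⟩ ∧ y = ⟨j, r j⟩)
  symm := by
    constructor
    rintro x y (⟨i, a, b, h, hx, hy⟩ | ⟨i, j, h, hx, hy⟩)
    · exact Or.inl ⟨i, b, a, h.symm, hy, hx⟩
    · exact Or.inr ⟨j, i, h.symm, hy, hx⟩
  loopless := by
    constructor
    rintro x (⟨i, a, b, h, hx, hy⟩ | ⟨i, j, h, hx, hy⟩)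
    · subst hx
      cases hy
      exact h.ne rfl
    · subst hx
      cases hy
      exact h.ne rfl

open scoped Matrix NNReal
open Filter Topology

/-! Each root function is, by a Schur complement, a rational Nevanlinna function `x - ∑ c_p / (x -
p)` with `c_p > 0`. Away from poles it has slope at least 1, and this is the only metric input. Off
the poles of the root functions `α j`, the entries at the roots of an eigenvector of the product
satisfy `U (k + 2) = α k * U (k + 1) - U k`, and the ratio `f_k = U (k + 2) / U (k + 1)` is the
continued fraction `α k - 1 / f_(k-1)`, again a Nevanlinna function (`contFrac_threeTerm`). By the
mirror symmetry of the root functions it suffices to solve the recurrence on one half of the path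
and to extend evenly or oddly.

With indices starting at 0, let `n = 2 * (k + 1)`. The extensions close up where `f_k = 1` or `f_k =
-1`. On the first and on the last branch of `f_k` both values are attained, and if both gaps
exceeded 1, a weighted sum over the poles would give a contradiction (`nevanlinna_outer_gap`).

Let `n = 2 * (k + 1) + 1`. Odd extensions belong to zeros of `f_k`, even ones to zeros of `S = α (k
+ 1) - 2 / f_k`. The largest zero `z` of `f_k` is a pole of `S`, and by the second hypothesis not a
pole of `α (k + 1)`. If no suitable zero of `S` were closer than `√2` to `z`, the signs of `S` at `z
± √2` and the slope bounds for `f_k` and `α (k + 1)` would force equality throughout; this happens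
only if neither function has a pole, which is the case of `P_3` (`exists_close_pair_odd`). -/

/-! ### Rational Nevanlinna functions and their monotonicity -/

/-- The Stieltjes transform `∑ c_p / (x - p)` of a finitely supported measure `∑ c_p δ_p`. -/
noncomputable def stieltjes (F : ℝ →₀ ℝ≥0) (x : ℝ) : ℝ := F.sum fun p c => (c : ℝ) / (x - p)

/-- The rational Nevanlinna function `x - ∑ c_p / (x - p)`. -/
noncomputable def nevanlinna (F : ℝ →₀ ℝ≥0) (x : ℝ) : ℝ := x - stieltjes F x

lemma stieltjes_zero (x : ℝ) : stieltjes 0 x = 0 := by simp [stieltjes]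

lemma nevanlinna_zero (x : ℝ) : nevanlinna 0 x = x := by simp [nevanlinna, stieltjes_zero]

lemma stieltjes_add (F G : ℝ →₀ ℝ≥0) (x : ℝ) :
    stieltjes (F + G) x = stieltjes F x + stieltjes G x := by
  unfold stieltjes
  exact Finsupp.sum_add_index' (by simp) (by intros; push_cast; ring)

lemma stieltjes_single (p : ℝ) (c : ℝ≥0) (x : ℝ) :
    stieltjes (Finsupp.single p c) x = c / (x - p) := by
  simp [stieltjes, Finsupp.sum_single_index]

lemma stieltjes_finset_sum {ι : Type*} (s : Finset ι) (F : ι → ℝ →₀ ℝ≥0) (x : ℝ) :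
    stieltjes (∑ i ∈ s, F i) x = ∑ i ∈ s, stieltjes (F i) x := by
  classical
  induction s using Finset.induction_on with
  | empty => simp [stieltjes_zero]
  | insert a s ha ih => rw [Finset.sum_insert ha, Finset.sum_insert ha, stieltjes_add, ih]

lemma mem_support_add {F G : ℝ →₀ ℝ≥0} {x : ℝ} :
    x ∈ (F + G).support ↔ x ∈ F.support ∨ x ∈ G.support := by
  simp only [Finsupp.mem_support_iff, Finsupp.add_apply, ne_eq, add_eq_zero]
  tauto

/-- The image of a finitely supported measure under `x ↦ -x`. -/
noncomputable def reflect (F : ℝ →₀ ℝ≥0) : ℝ →₀ ℝ≥0 := F.equivMapDomain (Equiv.neg ℝ)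

lemma mem_support_reflect {F : ℝ →₀ ℝ≥0} {x : ℝ} : x ∈ (reflect F).support ↔ -x ∈ F.support := by
  simp [reflect, Finsupp.equivMapDomain_apply]

lemma stieltjes_reflect (F : ℝ →₀ ℝ≥0) (x : ℝ) : stieltjes (reflect F) x = -stieltjes F (-x) := by
  unfold stieltjes reflect
  rw [Finsupp.equivMapDomain_eq_mapDomain,
    Finsupp.sum_mapDomain_index (by simp) (by intros; push_cast; ring), Finsupp.sum,
    Finsupp.sum, ← Finset.sum_neg_distrib]
  refine Finset.sum_congr rfl fun p _ => ?_
  rw [← div_neg]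
  congr 1
  simp [Equiv.neg]
  ring

lemma nevanlinna_reflect (F : ℝ →₀ ℝ≥0) (x : ℝ) :
    nevanlinna (reflect F) x = -nevanlinna F (-x) := by
  simp [nevanlinna, stieltjes_reflect]
  ring

lemma stieltjes_sub {F : ℝ →₀ ℝ≥0} {x y : ℝ} (hx : x ∉ F.support) (hy : y ∉ F.support) :
    stieltjes F x - stieltjes F y =
      (y - x) * ∑ p ∈ F.support, (F p : ℝ) / ((x - p) * (y - p)) := by
  unfold stieltjes
  rw [Finsupp.sum, Finsupp.sum, ← Finset.sum_sub_distrib, Finset.mul_sum]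
  refine Finset.sum_congr rfl fun p hp => ?_
  have h1 : x - p ≠ 0 := sub_ne_zero.2 fun h => hx (h ▸ hp)
  have h2 : y - p ≠ 0 := sub_ne_zero.2 fun h => hy (h ▸ hp)
  field_simp
  ring

lemma pos_of_mem_support {F : ℝ →₀ ℝ≥0} {p : ℝ} (hp : p ∈ F.support) : (0 : ℝ) < F p := by
  have := Finsupp.mem_support_iff.1 hp
  exact_mod_cast pos_iff_ne_zero.2 this

lemma sub_mul_sub_pos_of_notMem {F : ℝ →₀ ℝ≥0} {x y : ℝ} (hxy : x ≤ y)
    (h : ∀ p ∈ F.support, ¬(x ≤ p ∧ p ≤ y)) {p : ℝ} (hp : p ∈ F.support) :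
    0 < (x - p) * (y - p) := by
  by_cases h1 : x ≤ p
  · have h2 : y < p := not_le.1 fun h2 => h p hp ⟨h1, h2⟩
    exact mul_pos_of_neg_of_neg (by linarith) (by linarith)
  · push Not at h1
    exact mul_pos (by linarith) (by linarith)

lemma stieltjes_anti {F : ℝ →₀ ℝ≥0} {x y : ℝ} (hxy : x ≤ y)
    (h : ∀ p ∈ F.support, ¬(x ≤ p ∧ p ≤ y)) : stieltjes F y ≤ stieltjes F x := by
  have h1 := stieltjes_sub (fun hx => h x hx ⟨le_rfl, hxy⟩) (fun hy => h y hy ⟨hxy, le_rfl⟩)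
  have h2 : 0 ≤ ∑ p ∈ F.support, (F p : ℝ) / ((x - p) * (y - p)) :=
    Finset.sum_nonneg fun p hp =>
      (div_pos (pos_of_mem_support hp) (sub_mul_sub_pos_of_notMem hxy h hp)).le
  nlinarith

lemma stieltjes_strictAnti {F : ℝ →₀ ℝ≥0} (hF : F ≠ 0) {x y : ℝ} (hxy : x < y)
    (h : ∀ p ∈ F.support, ¬(x ≤ p ∧ p ≤ y)) : stieltjes F y < stieltjes F x := by
  have h1 := stieltjes_sub (fun hx => h x hx ⟨le_rfl, hxy.le⟩) (fun hy => h y hy ⟨hxy.le, le_rfl⟩)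
  have h2 : 0 < ∑ p ∈ F.support, (F p : ℝ) / ((x - p) * (y - p)) :=
    Finset.sum_pos (fun p hp =>
      div_pos (pos_of_mem_support hp) (sub_mul_sub_pos_of_notMem hxy.le h hp))
      (Finsupp.support_nonempty_iff.2 hF)
  nlinarith

/-- The identity contributes slope one and every term `-c / (x - p)` increases on an interval free
of poles. Both final bounds come from this growth rate. -/
lemma nevanlinna_sub_ge {F : ℝ →₀ ℝ≥0} {x y : ℝ} (hxy : x ≤ y)
    (h : ∀ p ∈ F.support, ¬(x ≤ p ∧ p ≤ y)) : y - x ≤ nevanlinna F y - nevanlinna F x := by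
  have := stieltjes_anti hxy h
  simp only [nevanlinna]
  linarith

lemma nevanlinna_sub_gt {F : ℝ →₀ ℝ≥0} (hF : F ≠ 0) {x y : ℝ} (hxy : x < y)
    (h : ∀ p ∈ F.support, ¬(x ≤ p ∧ p ≤ y)) : y - x < nevanlinna F y - nevanlinna F x := by
  have := stieltjes_strictAnti hF hxy h
  simp only [nevanlinna]
  linarith

/-! ### Solutions of `f = t` next to a pole and on the outer branches -/

lemma continuousAt_stieltjes {F : ℝ →₀ ℝ≥0} {x : ℝ} (hx : x ∉ F.support) :
    ContinuousAt (stieltjes F) x := by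
  unfold stieltjes Finsupp.sum
  refine tendsto_finsetSum _ fun p hp => ?_
  have h1 : x - p ≠ 0 := sub_ne_zero.2 fun h => hx (h ▸ hp)
  exact ContinuousAt.div continuousAt_const (by fun_prop) h1

lemma continuousAt_nevanlinna {F : ℝ →₀ ℝ≥0} {x : ℝ} (hx : x ∉ F.support) :
    ContinuousAt (nevanlinna F) x :=
  continuousAt_id.sub (continuousAt_stieltjes hx)

lemma tendsto_nevanlinna_nhdsGT {F : ℝ →₀ ℝ≥0} {p : ℝ} (hp : p ∈ F.support) :
    Tendsto (nevanlinna F) (𝓝[>] p) atBot := by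
  have h1 : nevanlinna F = fun x => nevanlinna (F.erase p) x + -(F p * (x - p)⁻¹) := by
    funext x
    have : stieltjes F x = F p / (x - p) + stieltjes (F.erase p) x := by
      conv_lhs => rw [← Finsupp.single_add_erase p F, stieltjes_add, stieltjes_single]
    simp only [nevanlinna, this, div_eq_mul_inv]
    ring
  rw [h1]
  refine Tendsto.add_atBot (C := nevanlinna (F.erase p) p) ?_ ?_
  · exact (continuousAt_nevanlinna (by simp)).tendsto.mono_left nhdsWithin_le_nhds
  · refine tendsto_neg_atTop_atBot.comp (Tendsto.const_mul_atTop (pos_of_mem_support hp) ?_)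
    refine tendsto_inv_nhdsGT_zero.comp ?_
    refine tendsto_nhdsWithin_iff.2 ⟨?_, ?_⟩
    · have : Tendsto (fun x : ℝ => x - p) (𝓝 p) (𝓝 (p - p)) := by
        exact (continuous_id.sub continuous_const).tendsto p
      rw [sub_self] at this
      exact this.mono_left nhdsWithin_le_nhds
    · filter_upwards [self_mem_nhdsWithin] with x hx
      simpa using hx

lemma exists_nevanlinna_lt_right {F : ℝ →₀ ℝ≥0} {p q : ℝ} (hp : p ∈ F.support) (hpq : p < q)
    (t : ℝ) : ∃ x, p < x ∧ x < q ∧ nevanlinna F x < t := by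
  have h1 := (tendsto_nevanlinna_nhdsGT hp).eventually (eventually_lt_atBot t)
  have h2 : ∀ᶠ x in 𝓝[>] p, x ∈ Set.Ioo p q := Ioo_mem_nhdsGT hpq
  obtain ⟨x, hx, hx'⟩ := (h1.and h2).exists
  exact ⟨x, hx'.1, hx'.2, hx⟩

lemma exists_nevanlinna_gt_left {F : ℝ →₀ ℝ≥0} {p q : ℝ} (hq : q ∈ F.support) (hpq : p < q)
    (t : ℝ) : ∃ x, p < x ∧ x < q ∧ t < nevanlinna F x := by
  obtain ⟨x, h1, h2, h3⟩ := exists_nevanlinna_lt_right (F := reflect F) (p := -q) (q := -p)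
    (mem_support_reflect.2 (by simpa using hq)) (by linarith) (-t)
  rw [nevanlinna_reflect] at h3
  exact ⟨-x, by linarith, by linarith, by linarith⟩

lemma exists_nevanlinna_eq_of_lt {F : ℝ →₀ ℝ≥0} {x y t : ℝ} (hxy : x ≤ y)
    (h : ∀ p ∈ F.support, ¬(x ≤ p ∧ p ≤ y)) (hx : nevanlinna F x < t) (hy : t < nevanlinna F y) :
    ∃ s, x < s ∧ s < y ∧ nevanlinna F s = t := by
  have hc : ContinuousOn (nevanlinna F) (Set.Icc x y) := fun z hz =>
    (continuousAt_nevanlinna fun hz' => h z hz' ⟨hz.1, hz.2⟩).continuousWithinAt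
  obtain ⟨s, hs, hst⟩ := intermediate_value_Ioo hxy hc ⟨hx, hy⟩
  exact ⟨s, hs.1, hs.2, hst⟩

/-- To the right of a pole, a Nevanlinna function takes the value `t` before the next pole, and
before it exceeds `t`. -/
lemma exists_nevanlinna_eq_right {F : ℝ →₀ ℝ≥0} {p X t : ℝ} (hp : p ∈ F.support) (hpX : p < X)
    (h : (∃ q ∈ F.support, p < q ∧ q ≤ X) ∨ t < nevanlinna F X) :
    ∃ s, p < s ∧ s < X ∧ nevanlinna F s = t ∧ ∀ q ∈ F.support, ¬(p < q ∧ q ≤ s) := by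
  by_cases hq : ∃ q ∈ F.support, p < q ∧ q ≤ X
  · obtain ⟨q, hq⟩ : ∃ q, Minimal (· ∈ F.support.filter fun q => p < q ∧ q ≤ X) q :=
      (F.support.filter fun q => p < q ∧ q ≤ X).exists_minimal (by
        obtain ⟨q, h1, h2⟩ := hq
        exact ⟨q, by simp only [Finset.mem_filter]; exact ⟨h1, h2⟩⟩)
    have hq1 := (Finset.mem_filter.1 hq.1).1
    obtain ⟨-, hq2, hq3⟩ := Finset.mem_filter.1 hq.1
    have hno : ∀ r ∈ F.support, ¬(p < r ∧ r < q) := fun r hr ⟨h1, h2⟩ =>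
      absurd (hq.2 (Finset.mem_filter.2 ⟨hr, h1, by linarith⟩) h2.le) (not_le.2 h2)
    obtain ⟨x, hx1, hx2, hx3⟩ := exists_nevanlinna_lt_right hp hq2 t
    obtain ⟨y, hy1, hy2, hy3⟩ := exists_nevanlinna_gt_left hq1 hx2 t
    obtain ⟨s, hs1, hs2, hs3⟩ := exists_nevanlinna_eq_of_lt hy1.le
      (fun r hr ⟨h1, h2⟩ => hno r hr ⟨by linarith, by linarith⟩) hx3 hy3
    exact ⟨s, by linarith, by linarith, hs3, fun r hr ⟨h1, h2⟩ => hno r hr ⟨h1, by linarith⟩⟩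
  · have hX := h.resolve_left hq
    push Not at hq
    obtain ⟨x, hx1, hx2, hx3⟩ := exists_nevanlinna_lt_right hp hpX t
    obtain ⟨s, hs1, hs2, hs3⟩ := exists_nevanlinna_eq_of_lt hx2.le
      (fun r hr ⟨h1, h2⟩ => absurd (hq r hr (by linarith)) (not_lt.2 h2)) hx3 hX
    exact ⟨s, by linarith, hs2, hs3, fun r hr ⟨h1, h2⟩ =>
      absurd (hq r hr h1) (not_lt.2 (by linarith))⟩

lemma exists_nevanlinna_eq_left {F : ℝ →₀ ℝ≥0} {p Y t : ℝ} (hp : p ∈ F.support) (hpY : Y < p)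
    (h : (∃ q ∈ F.support, Y ≤ q ∧ q < p) ∨ nevanlinna F Y < t) :
    ∃ s, Y < s ∧ s < p ∧ nevanlinna F s = t ∧ ∀ q ∈ F.support, ¬(s ≤ q ∧ q < p) := by
  obtain ⟨s, h1, h2, h3, h4⟩ := exists_nevanlinna_eq_right (F := reflect F) (p := -p) (X := -Y)
    (t := -t) (mem_support_reflect.2 (by simpa using hp)) (by linarith) (by
      rcases h with ⟨q, hq, h5, h6⟩ | h
      · exact Or.inl ⟨-q, mem_support_reflect.2 (by simpa using hq), by linarith, by linarith⟩
      · exact Or.inr (by rw [nevanlinna_reflect, neg_neg]; linarith))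
  rw [nevanlinna_reflect] at h3
  refine ⟨-s, by linarith, by linarith, by linarith, fun q hq ⟨h5, h6⟩ => ?_⟩
  exact h4 (-q) (mem_support_reflect.2 (by simpa using hq)) ⟨by linarith, by linarith⟩

lemma exists_nevanlinna_eq_top (F : ℝ →₀ ℝ≥0) (t : ℝ) :
    ∃ s, (∀ p ∈ F.support, p < s) ∧ nevanlinna F s = t := by
  rcases F.support.eq_empty_or_nonempty with h | h
  · rw [Finsupp.support_eq_empty] at h
    subst h
    exact ⟨t, by simp, nevanlinna_zero t⟩
  · have hM := F.support.max'_mem h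
    have hle := fun q (hq : q ∈ F.support) => F.support.le_max' q hq
    set M := F.support.max' h
    -- To the right of `M + 1` the transform is at most its value there, so this choice makes the
    -- function exceed `t` at `X`.
    set X := max (M + 1) (t + stieltjes F (M + 1) + 1)
    have hX1 : M + 1 ≤ X := le_max_left _ _
    have hX2 : t + stieltjes F (M + 1) + 1 ≤ X := le_max_right _ _
    have hX3 : stieltjes F X ≤ stieltjes F (M + 1) :=
      stieltjes_anti hX1 fun q hq hq' => by linarith [hle q hq]
    obtain ⟨s, h1, h2, h3, h4⟩ := exists_nevanlinna_eq_right (X := X) (t := t) hM (by linarith)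
      (Or.inr (by simp only [nevanlinna]; linarith))
    exact ⟨s, fun q hq => (hle q hq).trans_lt h1, h3⟩

lemma exists_nevanlinna_eq_bot (F : ℝ →₀ ℝ≥0) (t : ℝ) :
    ∃ s, (∀ p ∈ F.support, s < p) ∧ nevanlinna F s = t := by
  obtain ⟨s, h1, h2⟩ := exists_nevanlinna_eq_top (reflect F) (-t)
  rw [nevanlinna_reflect] at h2
  refine ⟨-s, fun p hp => ?_, by linarith⟩
  linarith [h1 (-p) (mem_support_reflect.2 (by simpa using hp))]

/-! ### The gap estimate on the outer branches -/

/-- The distances between the solutions of `f = 1` and `f = -1` on the first and last branch of a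
Nevanlinna function `f` with a pole do not both exceed `1`. -/
lemma nevanlinna_outer_gap {F : ℝ →₀ ℝ≥0} {a b a' b' : ℝ} (hF : F ≠ 0)
    (hb : ∀ p ∈ F.support, p < b) (ha' : ∀ p ∈ F.support, a' < p)
    (fa : nevanlinna F a = 1) (fb : nevanlinna F b = -1) (fa' : nevanlinna F a' = 1)
    (fb' : nevanlinna F b' = -1) : a - b ≤ 1 ∨ a' - b' ≤ 1 := by
  by_contra! hcon
  obtain ⟨h1, h2⟩ := hcon
  have nb : b ∉ F.support := fun h => lt_irrefl _ (hb b h)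
  have nb1 : b + 1 ∉ F.support := fun h => by linarith [hb _ h]
  have nb' : b' ∉ F.support := fun h => by linarith [ha' _ h]
  have nb1' : b' + 1 ∉ F.support := fun h => by linarith [ha' _ h]
  have g1 := nevanlinna_sub_ge (F := F) (x := b + 1) (y := a) (by linarith)
    (fun p hp h => by linarith [hb p hp])
  have g2 := nevanlinna_sub_ge (F := F) (x := b' + 1) (y := a') (by linarith)
    (fun p hp h => by linarith [ha' p hp])
  have e1 := stieltjes_sub nb nb1
  have e2 := stieltjes_sub nb' nb1'
  have e3 := stieltjes_sub nb' nb
  obtain ⟨p₀, hp₀⟩ := Finsupp.support_nonempty_iff.2 hF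
  have hL : 1 < b - b' := by linarith [hb _ hp₀, ha' _ hp₀]
  set S := ∑ p ∈ F.support, (F p : ℝ) / ((b - p) * (b + 1 - p))
  set S' := ∑ p ∈ F.support, (F p : ℝ) / ((b' - p) * (b' + 1 - p))
  -- The weights on the right sum to 1. The left side will turn out to be 1, because the function
  -- takes the same value at `b` and `b'`, whereas gaps above 1 make `S` and `S'` both less than 1.
  have key : -∑ p ∈ F.support, (F p : ℝ) / ((b' - p) * (b - p)) ≤
      (b - b' + 1) / (2 * (b - b')) * S + (b - b' - 1) / (2 * (b - b')) * S' := by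
    rw [Finset.mul_sum, Finset.mul_sum, ← Finset.sum_neg_distrib, ← Finset.sum_add_distrib]
    refine Finset.sum_le_sum fun p hp => ?_
    obtain ⟨u, hu⟩ : ∃ u, u = b - p := ⟨_, rfl⟩
    obtain ⟨v, hv⟩ : ∃ v, v = p - b' - 1 := ⟨_, rfl⟩
    have hu0 : 0 < u := by linarith [hb p hp]
    have hv0 : 0 < v := by linarith [ha' p hp]
    have hc := pos_of_mem_support hp
    rw [show b - b' = u + v + 1 by linarith, show b' - p = -(v + 1) by linarith,
      show b' + 1 - p = -v by linarith, show b + 1 - p = u + 1 by linarith, ← hu]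
    -- The weights are chosen so that the difference of the two sides is, pole by pole, a multiple
    -- of a square.
    have : (u + v + 1 + 1) / (2 * (u + v + 1)) * (F p / (u * (u + 1))) +
        (u + v + 1 - 1) / (2 * (u + v + 1)) * (F p / (-(v + 1) * -v)) -
        -(F p / (-(v + 1) * u)) =
        F p * (v - u) ^ 2 / (2 * (u * (u + 1) * (v * (v + 1)))) := by
      field_simp
      ring
    have h3 : 0 ≤ F p * (v - u) ^ 2 / (2 * (u * (u + 1) * (v * (v + 1)))) := by positivity
    linarith
  simp only [nevanlinna] at *
  have hS : S < 1 := by linarith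
  have hS' : S' < 1 := by linarith
  have hT : ∑ p ∈ F.support, (F p : ℝ) / ((b' - p) * (b - p)) = -1 := by
    have : (b - b') * (∑ p ∈ F.support, (F p : ℝ) / ((b' - p) * (b - p)) + 1) = 0 := by linarith
    rcases mul_eq_zero.1 this with h | h <;> linarith
  have w1 : 0 < (b - b' + 1) / (2 * (b - b')) := by apply div_pos <;> linarith
  have w2 : 0 < (b - b' - 1) / (2 * (b - b')) := by apply div_pos <;> linarith
  have w3 : (b - b' + 1) / (2 * (b - b')) + (b - b' - 1) / (2 * (b - b')) = 1 := by
    field_simp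
    ring
  nlinarith

/-! ### Resolvents of symmetric matrices and reciprocals of Nevanlinna functions -/

/-- Expand `b` in an orthonormal eigenbasis; the squared coefficients are the masses at the
eigenvalues. An eigenvalue whose eigenspace is orthogonal to `b` gets no mass, and the equation
remains solvable there. -/
lemma exists_stieltjes_resolvent {ι : Type*} [Fintype ι] [DecidableEq ι] {M : Matrix ι ι ℝ}
    (hM : M.IsSymm) (b : ι → ℝ) : ∃ F : ℝ →₀ ℝ≥0,
      (∀ x ∉ F.support, ∃ y, x • y - M *ᵥ y = b ∧ b ⬝ᵥ y = stieltjes F x) ∧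
      (∀ x ∈ F.support, ∃ u, M *ᵥ u = x • u ∧ b ⬝ᵥ u = 1) ∧ (F = 0 → b = 0) := by
  have hH : M.IsHermitian := by
    rw [Matrix.IsHermitian, Matrix.conjTranspose_eq_transpose_of_trivial]
    exact hM
  obtain ⟨u, l, a, hu, ha, hb⟩ : ∃ (u : ι → ι → ℝ) (l a : ι → ℝ),
      (∀ k, M *ᵥ u k = l k • u k) ∧ (∀ k, b ⬝ᵥ u k = a k) ∧ b = ∑ k, a k • u k := by
    refine ⟨fun k => (hH.eigenvectorBasis k).ofLp, hH.eigenvalues,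
      fun k => b ⬝ᵥ (hH.eigenvectorBasis k).ofLp, hH.mulVec_eigenvectorBasis, fun k => rfl, ?_⟩
    have := hH.eigenvectorBasis.sum_repr (WithLp.toLp 2 b)
    have h2 := congrArg WithLp.ofLp this
    rw [WithLp.ofLp_sum] at h2
    refine h2.symm.trans (Finset.sum_congr rfl fun k _ => ?_)
    rw [WithLp.ofLp_smul, OrthonormalBasis.repr_apply_apply]
    simp [EuclideanSpace.inner_eq_star_dotProduct]
  set F : ℝ →₀ ℝ≥0 := ∑ k, Finsupp.single (l k) (‖a k‖₊ ^ 2)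
  have hF0 : ∀ x, F x = 0 → ∀ k, l k = x → a k = 0 := by
    intro x hx k hk
    rw [Finsupp.finsetSum_apply, Finset.sum_eq_zero_iff] at hx
    have := hx k (Finset.mem_univ _)
    rw [hk, Finsupp.single_eq_same] at this
    simpa using this
  have hFx : ∀ x, stieltjes F x = ∑ k, a k ^ 2 / (x - l k) := by
    intro x
    rw [stieltjes_finset_sum]
    refine Finset.sum_congr rfl fun k _ => ?_
    rw [stieltjes_single]
    simp
  refine ⟨F, fun x hx => ?_, fun x hx => ?_, fun h => ?_⟩
  · rw [Finsupp.notMem_support_iff] at hx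
    refine ⟨∑ k, (a k / (x - l k)) • u k, ?_, ?_⟩
    · rw [Matrix.mulVec_sum, Finset.smul_sum, ← Finset.sum_sub_distrib]
      conv_rhs => rw [hb]
      refine Finset.sum_congr rfl fun k _ => ?_
      rw [Matrix.mulVec_smul, hu, smul_smul, smul_smul, ← sub_smul]
      congr 1
      -- Off the support the coefficient at an eigenvalue equal to `x` vanishes, so the division by
      -- zero does no harm.
      by_cases hk : l k = x
      · simp [hF0 x hx k hk]
      · have : x - l k ≠ 0 := sub_ne_zero.2 (Ne.symm hk)
        field_simp
    · rw [dotProduct_sum, hFx]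
      refine Finset.sum_congr rfl fun k _ => ?_
      rw [dotProduct_smul, ha, smul_eq_mul]
      ring
  · obtain ⟨k, hk, hk'⟩ : ∃ k, l k = x ∧ a k ≠ 0 := by
      by_contra! hcon
      refine Finsupp.mem_support_iff.1 hx ?_
      rw [Finsupp.finsetSum_apply]
      refine Finset.sum_eq_zero fun k _ => ?_
      by_cases hk : l k = x
      · simp [hcon k hk]
      · simp [hk]
    refine ⟨(a k)⁻¹ • u k, ?_, ?_⟩
    · rw [Matrix.mulVec_smul, hu, hk, smul_comm]
    · rw [dotProduct_smul, ha, smul_eq_mul, inv_mul_cancel₀ hk']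
  · rw [hb]
    refine Finset.sum_eq_zero fun k _ => ?_
    rw [hF0 (l k) (by rw [h]; rfl) k rfl, zero_smul]

/-- The reciprocal of a Nevanlinna function is a Stieltjes transform. -/
lemma exists_stieltjes_inverse (F : ℝ →₀ ℝ≥0) : ∃ G : ℝ →₀ ℝ≥0,
    (∀ x ∈ G.support, x ∉ F.support ∧ nevanlinna F x = 0) ∧
    (∀ x ∉ G.support, x ∈ F.support → stieltjes G x = 0) ∧
    (∀ x ∉ G.support, x ∉ F.support → nevanlinna F x * stieltjes G x = 1) := by
  classical
  set c : F.support → ℝ := fun s => √(F s)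
  have hc : ∀ s, c s * c s = F s := fun s => Real.mul_self_sqrt (by positivity)
  have hc0 : ∀ s, c s ≠ 0 := fun s =>
    (Real.sqrt_pos.2 (pos_of_mem_support s.2)).ne'
  -- An arrow matrix: the poles on the diagonal, square roots of the masses on the border. The Schur
  -- complement of `x - M` at `none` is `nevanlinna F x`, so the corner entry of the resolvent is
  -- its reciprocal.
  set M : Matrix (Option F.support) (Option F.support) ℝ := Matrix.of fun i j =>
    match i, j with
    | none, none => 0
    | none, some s => c s
    | some s, none => c s
    | some s, some t => if s = t then (s : ℝ) else 0
  have hM : M.IsSymm := by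
    ext i j
    rcases i with _ | s <;> rcases j with _ | t <;> simp [M]
    by_cases h : s = t <;> simp [h, eq_comm]
  have hM0 : ∀ y, (M *ᵥ y) none = ∑ s, c s * y (some s) := by
    intro y
    simp [Matrix.mulVec, dotProduct, Fintype.sum_option, M]
  have hMs : ∀ y s, (M *ᵥ y) (some s) = c s * y none + s * y (some s) := by
    intro y s
    simp [Matrix.mulVec, dotProduct, Fintype.sum_option, M]
  have hsum : ∀ x, stieltjes F x = ∑ s : F.support, (F s : ℝ) / (x - s) := by
    intro x
    rw [stieltjes, Finsupp.sum, ← Finset.sum_coe_sort]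
  obtain ⟨G, h1, h2, -⟩ := exists_stieltjes_resolvent hM (Pi.single none 1)
  have key : ∀ x, x ∉ F.support → ∀ y : Option F.support → ℝ,
      (∀ s : F.support, (x - s) * y (some s) = c s * y none) →
      ∑ s, c s * y (some s) = stieltjes F x * y none := by
    intro x hx y hy
    rw [hsum, Finset.sum_mul]
    refine Finset.sum_congr rfl fun s _ => ?_
    have h0 : x - s ≠ 0 := sub_ne_zero.2 fun h => hx (h ▸ s.2)
    field_simp
    rw [← hc s]
    linear_combination c s * hy s
  have hsol : ∀ x ∉ G.support, ∃ y : Option F.support → ℝ, y none = stieltjes G x ∧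
      (∀ s : F.support, (x - s) * y (some s) = c s * y none) ∧
      x * y none - ∑ s, c s * y (some s) = 1 := by
    intro x hx
    obtain ⟨y, hy, hy'⟩ := h1 x hx
    refine ⟨y, by rw [← hy']; simp, fun s => ?_, ?_⟩
    · have := congrFun hy (some s)
      simp only [Pi.sub_apply, Pi.smul_apply, hMs, smul_eq_mul] at this
      simp at this
      linear_combination this
    · have := congrFun hy none
      simp only [Pi.sub_apply, Pi.smul_apply, hM0, smul_eq_mul] at this
      simpa using this
  refine ⟨G, fun x hx => ?_, fun x hx hxF => ?_, fun x hx hxF => ?_⟩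
  · obtain ⟨u, hu, hu'⟩ := h2 x hx
    have hu0 : u none = 1 := by simpa using hu'
    have hus : ∀ s : F.support, (x - s) * u (some s) = c s * u none := fun s => by
      have := congrFun hu (some s)
      simp only [Pi.smul_apply, hMs, smul_eq_mul] at this
      linear_combination -this
    have hxF : x ∉ F.support := fun hxF => by
      have := hus ⟨x, hxF⟩
      simp only [sub_self, zero_mul, hu0, mul_one] at this
      exact hc0 _ this.symm
    refine ⟨hxF, ?_⟩
    have := congrFun hu none
    rw [hM0, key x hxF u hus, Pi.smul_apply, smul_eq_mul, hu0] at this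
    simp only [nevanlinna]
    linarith
  · obtain ⟨y, hy, hys, -⟩ := hsol x hx
    have := hys ⟨x, hxF⟩
    simp only [sub_self, zero_mul] at this
    rw [← hy]
    exact (mul_eq_zero.1 this.symm).resolve_left (hc0 _)
  · obtain ⟨y, hy, hys, hy0⟩ := hsol x hx
    rw [key x hxF y hys, hy] at hy0
    simp only [nevanlinna]
    linarith

/-! ### Root functions as Nevanlinna functions -/

lemma Matrix.det_updateRow_single {V : Type*} [Fintype V] [DecidableEq V] (B : Matrix V V ℝ)
    (r : V) : (B.updateRow r (Pi.single r 1)).det =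
      (B.submatrix (Subtype.val : ({r}ᶜ : Set V) → V) Subtype.val).det := by
  rw [Matrix.twoBlockTriangular_det' _ (fun i => i = r) (by
    intro i hi j hj
    subst hi
    simp [hj])]
  refine (congrArg₂ (· * ·) ?_ ?_).trans (one_mul _)
  · have h1 : (Matrix.toSquareBlockProp (B.updateRow r (Pi.single r 1)) fun i => i = r).det =
        1 := by
      have h := (default : {i // i = r}).2
      rw [Matrix.det_unique, Matrix.toSquareBlockProp_def, Matrix.of_apply]
      simp only [h, Matrix.updateRow_self, Pi.single_eq_same]
    convert h1
  · let e : {i // ¬i = r} ≃ ({r}ᶜ : Set V) := Equiv.subtypeEquivRight fun i => by simp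
    rw [← Matrix.det_submatrix_equiv_self e]
    congr 1
    ext i j
    have := i.2
    simp only [Matrix.toSquareBlockProp_def, Matrix.of_apply, Matrix.submatrix_apply]
    rw [Matrix.updateRow_ne this]
    rfl

/-- The value of the ratio of the characteristic determinants of a matrix and of a principal
submatrix of corank one. -/
lemma Matrix.det_eq_of_mulVec_eq_single {V : Type*} [Fintype V] [DecidableEq V]
    {B : Matrix V V ℝ} {r : V} {y : V → ℝ} {c : ℝ} (hy : y r = 1)
    (h : B *ᵥ y = Pi.single r c) :
    B.det = (B.submatrix (Subtype.val : ({r}ᶜ : Set V) → V) Subtype.val).det * c := by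
  have h1 : B.adjugate *ᵥ (B *ᵥ y) = B.det • y := by
    rw [Matrix.mulVec_mulVec, Matrix.adjugate_mul, Matrix.smul_mulVec, Matrix.one_mulVec]
  have h2 := congrFun h1 r
  simp only [h, Matrix.mulVec_single, Pi.smul_apply, hy, Matrix.col_apply, smul_eq_mul, mul_one,
    MulOpposite.smul_eq_mul_unop, MulOpposite.unop_op] at h2
  rw [← h2, Matrix.adjugate_apply, Matrix.det_updateRow_single]

lemma mulVec_extend {V : Type*} [Fintype V] [DecidableEq V] {A : Matrix V V ℝ}
    (r : V) (c : ℝ) (y : ({r}ᶜ : Set V) → ℝ) :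
    A *ᵥ (fun i => if h : i ∈ ({r}ᶜ : Set V) then y ⟨i, h⟩ else c) =
      fun i => A i r * c + (fun j : ({r}ᶜ : Set V) => A i j) ⬝ᵥ y := by
  funext i
  simp only [Matrix.mulVec, dotProduct]
  rw [← Finset.add_sum_erase _ _ (Finset.mem_univ r)]
  congr 1
  · simp
  · rw [Finset.sum_subtype (Finset.univ.erase r) (p := fun j => j ∈ ({r}ᶜ : Set V)) (by simp)]
    refine Finset.sum_congr rfl fun j _ => ?_
    rw [dif_pos j.2]

/-- A symmetric matrix with zero diagonal entry at `r`: the Schur complement of `x - A` at `r` is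
a Nevanlinna function. -/
lemma exists_nevanlinna_schur {V : Type*} [Fintype V] [DecidableEq V] {A : Matrix V V ℝ}
    (hA : A.IsSymm) (r : V) (hr : A r r = 0) : ∃ F : ℝ →₀ ℝ≥0,
      (∀ x ∉ F.support, ∃ y, y r = 1 ∧ A *ᵥ y = x • y - Pi.single r (nevanlinna F x)) ∧
      (∀ x ∈ F.support, ∃ u, u r = 0 ∧ A *ᵥ u = x • u + Pi.single r 1) ∧
      (F = 0 → ∀ j, A r j = 0) := by
  set M := A.submatrix (Subtype.val : ({r}ᶜ : Set V) → V) Subtype.val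
  have hM : M.IsSymm := hA.submatrix _
  set b : ({r}ᶜ : Set V) → ℝ := fun j => A r j
  obtain ⟨F, h1, h2, h3⟩ := exists_stieltjes_resolvent hM b
  refine ⟨F, fun x hx => ?_, fun x hx => ?_, fun h j => ?_⟩
  · obtain ⟨y, hy, hy'⟩ := h1 x hx
    refine ⟨fun i => if h : i ∈ ({r}ᶜ : Set V) then y ⟨i, h⟩ else 1, by simp, ?_⟩
    rw [mulVec_extend]
    funext i
    by_cases hi : i = r
    · subst hi
      have : (fun j : ({i}ᶜ : Set V) => A i j) ⬝ᵥ y = stieltjes F x := hy'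
      rw [this]
      simp [hr, nevanlinna]
    · have h4 := congrFun hy ⟨i, hi⟩
      have h5 : (M *ᵥ y) ⟨i, hi⟩ = (fun j : ({r}ᶜ : Set V) => A i j) ⬝ᵥ y := rfl
      have h6 : b ⟨i, hi⟩ = A i r := hA.apply i r
      rw [Pi.sub_apply, h5, h6, Pi.smul_apply] at h4
      simp only [Pi.sub_apply, Pi.smul_apply, Set.mem_compl_iff, Set.mem_singleton_iff, hi,
        not_false_eq_true, dite_true, Pi.single_eq_of_ne, ne_eq, sub_zero]
      linarith
  · obtain ⟨u, hu, hu'⟩ := h2 x hx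
    refine ⟨fun i => if h : i ∈ ({r}ᶜ : Set V) then u ⟨i, h⟩ else 0, by simp, ?_⟩
    rw [mulVec_extend]
    funext i
    by_cases hi : i = r
    · subst hi
      have : (fun j : ({i}ᶜ : Set V) => A i j) ⬝ᵥ u = 1 := hu'
      rw [this]
      simp
    · have h4 := congrFun hu ⟨i, hi⟩
      have h5 : (M *ᵥ u) ⟨i, hi⟩ = (fun j : ({r}ᶜ : Set V) => A i j) ⬝ᵥ u := rfl
      rw [h5, Pi.smul_apply] at h4
      simp [hi, h4]
  · by_cases hj : j = r
    · rw [hj, hr]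
    · exact congrFun (h3 h) ⟨j, hj⟩

lemma RatFunc.eval_num_mul_eval {ρ : RatFunc ℝ} {N D : Polynomial ℝ} (hD : D ≠ 0)
    (h : ρ = algebraMap (Polynomial ℝ) (RatFunc ℝ) N / algebraMap (Polynomial ℝ) (RatFunc ℝ) D)
    (x : ℝ) : ρ.num.eval x * D.eval x = N.eval x * ρ.denom.eval x := by
  have h1 := ρ.num_div_denom
  rw [h, div_eq_div_iff (RatFunc.algebraMap_ne_zero (RatFunc.denom_ne_zero _))
    (RatFunc.algebraMap_ne_zero hD), ← map_mul, ← map_mul, ← h] at h1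
  have h2 := RatFunc.algebraMap_injective ℝ h1
  rw [← Polynomial.eval_mul, ← Polynomial.eval_mul, h2]

-- At a pole only one summand of the numerator survives, and it is nonzero. No cancellation can then
-- occur, so the poles of the reduced fraction are exactly the support.
open Polynomial in
lemma exists_nevanlinna_polynomials (F : ℝ →₀ ℝ≥0) : ∃ N D : Polynomial ℝ, D ≠ 0 ∧
    (∀ x, D.eval x = 0 ↔ x ∈ F.support) ∧ (∀ x ∈ F.support, N.eval x ≠ 0) ∧
    (∀ x ∉ F.support, N.eval x = D.eval x * nevanlinna F x) := by
  have hD : ∀ (S : Finset ℝ) (x : ℝ), (∏ p ∈ S, (X - C p)).eval x = 0 ↔ x ∈ S := by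
    intro S x
    rw [eval_prod, Finset.prod_eq_zero_iff]
    simp [sub_eq_zero]
  refine ⟨X * ∏ p ∈ F.support, (X - C p) -
    ∑ p ∈ F.support, C (F p : ℝ) * ∏ q ∈ F.support.erase p, (X - C q),
    ∏ p ∈ F.support, (X - C p), Finset.prod_ne_zero_iff.2 fun p _ => X_sub_C_ne_zero p,
    hD _, fun x hx => ?_, fun x hx => ?_⟩
  · rw [eval_sub, eval_mul, (hD _ x).2 hx, eval_finsetSum, Finset.sum_eq_single x]
    · rw [eval_mul, eval_C, mul_zero, zero_sub, neg_ne_zero]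
      refine mul_ne_zero (pos_of_mem_support hx).ne' ?_
      rw [ne_eq, hD]
      simp
    · intro p hp hpx
      rw [eval_mul, (hD _ x).2 (Finset.mem_erase.2 ⟨hpx.symm, hx⟩), mul_zero]
    · exact fun h => absurd hx h
  · rw [eval_sub, eval_mul, eval_X, nevanlinna, mul_sub, mul_comm x, stieltjes, Finsupp.sum,
      Finset.mul_sum, eval_finsetSum]
    congr 1
    refine Finset.sum_congr rfl fun p hp => ?_
    have : x - p ≠ 0 := sub_ne_zero.2 fun h => hx (h ▸ hp)
    rw [← Finset.mul_prod_erase _ _ hp, eval_mul, eval_mul, eval_C, eval_sub, eval_X, eval_C]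
    field_simp

open Polynomial in
/-- The root function of a rooted graph is a Nevanlinna function. -/
lemma SimpleGraph.exists_rootFunction_eq_nevanlinna {V : Type*} [Fintype V] [DecidableEq V]
    (G : SimpleGraph V) [DecidableRel G.Adj] (r : V) : ∃ F : ℝ →₀ ℝ≥0,
      (∀ x, (G.rootFunction r).IsPoleAt x ↔ x ∈ F.support) ∧
      (∀ x ∉ F.support, (G.rootFunction r).eval (RingHom.id ℝ) x = nevanlinna F x) ∧
      (∀ x ∉ F.support, ∃ y, y r = 1 ∧
        G.adjMatrix ℝ *ᵥ y = x • y - Pi.single r (nevanlinna F x)) ∧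
      (∀ x ∈ F.support, ∃ u, u r = 0 ∧ G.adjMatrix ℝ *ᵥ u = x • u + Pi.single r 1) ∧
      (F = 0 → ∀ j, ¬ G.Adj r j) := by
  obtain ⟨F, h1, h2, h3⟩ := exists_nevanlinna_schur (G.isSymm_adjMatrix (α := ℝ)) r (by simp)
  obtain ⟨N, D, hD0, hD, hN, hND⟩ := exists_nevanlinna_polynomials F
  set P := (G.adjMatrix ℝ).charpoly
  set Q := ((G.adjMatrix ℝ).submatrix (Subtype.val : ({r}ᶜ : Set V) → V) Subtype.val).charpoly
  have hPQ : P * D = Q * N := by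
    -- The Schur complement gives the identity at every point off the finite support, which is
    -- enough for polynomials.
    refine Polynomial.eq_of_infinite_eval_eq _ _
      (F.support.finite_toSet.infinite_compl.mono fun x hx => ?_)
    have hx' : x ∉ F.support := by simpa using hx
    obtain ⟨y, hy, hy'⟩ := h1 x hx'
    have hdet := Matrix.det_eq_of_mulVec_eq_single (B := Matrix.scalar V x - G.adjMatrix ℝ) hy
      (c := nevanlinna F x) (by
        rw [Matrix.sub_mulVec, hy', Matrix.scalar_apply, ← Matrix.smul_one_eq_diagonal,
          Matrix.smul_mulVec, Matrix.one_mulVec]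
        abel)
    show (P * D).eval x = (Q * N).eval x
    rw [eval_mul, eval_mul, hND x hx']
    have hP : P.eval x = (Matrix.scalar V x - G.adjMatrix ℝ).det := Matrix.eval_charpoly _ _
    have hQ : Q.eval x = ((Matrix.scalar V x - G.adjMatrix ℝ).submatrix
        (Subtype.val : ({r}ᶜ : Set V) → V) Subtype.val).det := by
      rw [Matrix.eval_charpoly, Matrix.submatrix_sub]
      congr 2
      ext i j
      simp [Matrix.diagonal_apply, Subtype.ext_iff]
    rw [hP, hQ, hdet]
    ring
  have hρ : G.rootFunction r = algebraMap ℝ[X] (RatFunc ℝ) N / algebraMap ℝ[X] (RatFunc ℝ) D := by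
    have hQ0 : Q ≠ 0 := (Matrix.charpoly_monic _).ne_zero
    have h4 : G.rootFunction r =
        algebraMap ℝ[X] (RatFunc ℝ) P / algebraMap ℝ[X] (RatFunc ℝ) Q := by
      unfold SimpleGraph.rootFunction SimpleGraph.charPoly
      congr! 3 <;> ext i j <;> simp [SimpleGraph.adjMatrix_apply]
    rw [h4, div_eq_div_iff (RatFunc.algebraMap_ne_zero hQ0) (RatFunc.algebraMap_ne_zero hD0),
      ← map_mul, ← map_mul, hPQ, mul_comm]
  have hev := RatFunc.eval_num_mul_eval hD0 hρ
  have hpole : ∀ x, (G.rootFunction r).IsPoleAt x ↔ x ∈ F.support := by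
    intro x
    rw [RatFunc.IsPoleAt, Polynomial.IsRoot, ← hD]
    refine ⟨fun h => ?_, fun h => ?_⟩
    · have := (hρ ▸ RatFunc.denom_div_dvd N D : (G.rootFunction r).denom ∣ D)
      exact Polynomial.eval_eq_zero_of_dvd_of_eval_eq_zero this h
    · have := hev x
      rw [h, mul_zero] at this
      exact (mul_eq_zero.1 this.symm).resolve_left (hN x ((hD x).1 h))
  refine ⟨F, hpole, fun x hx => ?_, h1, h2, fun h j hj => ?_⟩
  · have e1 : (G.rootFunction r).denom.eval x ≠ 0 := fun h => hx ((hpole x).1 h)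
    have e2 : D.eval x ≠ 0 := fun h => hx ((hD x).1 h)
    have e3 := hev x
    rw [hND x hx] at e3
    rw [RatFunc.eval, Polynomial.eval₂_id, Polynomial.eval₂_id, div_eq_iff e1]
    apply mul_right_cancel₀ e2
    linear_combination e3
  · have := h3 h j
    simp [hj] at this

/-- Every element of the eigenvalue support is a zero of the root function. -/
lemma SimpleGraph.isZeroAt_of_mem_eigenvalueSupport {V : Type*} [Fintype V]
    (G : SimpleGraph V) (r : V) {x : ℝ} (hx : x ∈ G.eigenvalueSupport r) :
    (G.rootFunction r).IsZeroAt x := by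
  classical
  obtain ⟨F, hpole, hev, h1, h2, -⟩ := G.exists_rootFunction_eq_nevanlinna r
  obtain ⟨v, hv, hvr⟩ : ∃ v : V → ℝ, G.adjMatrix ℝ *ᵥ v = x • v ∧ v r ≠ 0 := by
    obtain ⟨v, hv, hvr⟩ := hx
    refine ⟨v, ?_, hvr⟩
    convert hv
  -- By symmetry of the adjacency matrix, pairing `v` with a local solution isolates `v r`: at a
  -- pole this forces `v r = 0`, elsewhere it forces the Nevanlinna function to vanish.
  have hdot : ∀ w : V → ℝ, v ⬝ᵥ (G.adjMatrix ℝ *ᵥ w) = x * (v ⬝ᵥ w) := by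
    intro w
    rw [Matrix.dotProduct_mulVec, ← Matrix.mulVec_transpose, G.transpose_adjMatrix, hv,
      smul_dotProduct, smul_eq_mul]
  have hxF : x ∉ F.support := fun hxF => by
    obtain ⟨u, -, hu⟩ := h2 x hxF
    have := hdot u
    rw [hu, dotProduct_add, dotProduct_smul, dotProduct_single, smul_eq_mul] at this
    exact hvr (by linarith)
  obtain ⟨y, -, hy⟩ := h1 x hxF
  have h5 := hdot y
  rw [hy, dotProduct_sub, dotProduct_smul, dotProduct_single, smul_eq_mul] at h5
  have h6 : nevanlinna F x = 0 := by
    have : v r * nevanlinna F x = 0 := by linarith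
    exact (mul_eq_zero.1 this).resolve_left hvr
  have h7 := hev x hxF
  rw [h6, RatFunc.eval, Polynomial.eval₂_id, Polynomial.eval₂_id, div_eq_zero_iff] at h7
  exact h7.resolve_right fun h => hxF ((hpole x).1 h)

/-! ### Continued fractions and the three-term recurrence -/

/-- The measure whose Stieltjes transform is the reciprocal of `nevanlinna F`. -/
noncomputable def nevanlinnaInv (F : ℝ →₀ ℝ≥0) : ℝ →₀ ℝ≥0 :=
  (exists_stieltjes_inverse F).choose

lemma stieltjes_nevanlinnaInv_of_pole {F : ℝ →₀ ℝ≥0} {x : ℝ} (hx : x ∈ F.support) :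
    stieltjes (nevanlinnaInv F) x = 0 :=
  (exists_stieltjes_inverse F).choose_spec.2.1 x
    (fun h => ((exists_stieltjes_inverse F).choose_spec.1 x h).1 hx) hx

lemma nevanlinna_mul_stieltjes_inv {F : ℝ →₀ ℝ≥0} {x : ℝ} (h : x ∉ (nevanlinnaInv F).support)
    (hx : x ∉ F.support) : nevanlinna F x * stieltjes (nevanlinnaInv F) x = 1 :=
  (exists_stieltjes_inverse F).choose_spec.2.2 x h hx

lemma mem_support_nevanlinnaInv {F : ℝ →₀ ℝ≥0} {x : ℝ} :
    x ∈ (nevanlinnaInv F).support ↔ x ∉ F.support ∧ nevanlinna F x = 0 := by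
  refine ⟨fun h => (exists_stieltjes_inverse F).choose_spec.1 x h, fun h => ?_⟩
  by_contra hx
  have := nevanlinna_mul_stieltjes_inv hx h.1
  rw [h.2, zero_mul] at this
  exact zero_ne_one this

/-- The measures of the continued fractions `α k - 1 / (α (k - 1) - 1 / ⋯)`. -/
noncomputable def contFrac (α : ℕ → ℝ →₀ ℝ≥0) : ℕ → ℝ →₀ ℝ≥0
  | 0 => α 0
  | k + 1 => α (k + 1) + nevanlinnaInv (contFrac α k)

/-- The solution of `U (k + 2) = a k * U (k + 1) - U k` with `U 0 = 0` and `U 1 = 1`. -/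
noncomputable def threeTerm (a : ℕ → ℝ) : ℕ → ℝ
  | 0 => 0
  | 1 => 1
  | k + 2 => a k * threeTerm a (k + 1) - threeTerm a k

lemma threeTerm_succ_succ (a : ℕ → ℝ) (k : ℕ) :
    threeTerm a (k + 2) = a k * threeTerm a (k + 1) - threeTerm a k := rfl

lemma threeTerm_succ_ne_zero (a : ℕ → ℝ) (k : ℕ) (h : threeTerm a k = 0) :
    threeTerm a (k + 1) ≠ 0 := by
  induction k with
  | zero => exact one_ne_zero
  | succ k ih =>
    intro h'
    rw [threeTerm_succ_succ, h, mul_zero, zero_sub, neg_eq_zero] at h'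
    exact ih h' h

/-- Dividing the recurrence by `U (k + 1)` gives the continued fraction. As consecutive terms never
vanish together, its poles are exactly the zeros of the denominator, as long as `x` avoids the poles
of the coefficients. -/
lemma contFrac_threeTerm {α : ℕ → ℝ →₀ ℝ≥0} {x : ℝ} {k : ℕ} (h : ∀ j ≤ k, x ∉ (α j).support) :
    (x ∈ (contFrac α k).support ↔ threeTerm (fun j => nevanlinna (α j) x) (k + 1) = 0) ∧
    (x ∉ (contFrac α k).support →
      nevanlinna (contFrac α k) x * threeTerm (fun j => nevanlinna (α j) x) (k + 1) =
        threeTerm (fun j => nevanlinna (α j) x) (k + 2)) := by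
  set U := threeTerm (fun j => nevanlinna (α j) x)
  have hU : ∀ k, U (k + 2) = nevanlinna (α k) x * U (k + 1) - U k := fun k => rfl
  induction k with
  | zero =>
    have h0 : U 0 = 0 := rfl
    have h1 : U 1 = 1 := rfl
    refine ⟨⟨fun h' => absurd h' (h 0 le_rfl), fun h' => ?_⟩, fun _ => ?_⟩
    · simp [h1] at h'
    · rw [hU, h0, sub_zero]
      rfl
  | succ k ih =>
    obtain ⟨ih1, ih2⟩ := ih fun j hj => h j (by omega)
    have hα := h (k + 1) le_rfl
    have hiff : x ∈ (contFrac α (k + 1)).support ↔ x ∈ (nevanlinnaInv (contFrac α k)).support :=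
      mem_support_add.trans (or_iff_right hα)
    constructor
    · rw [hiff, mem_support_nevanlinnaInv]
      constructor
      · rintro ⟨h1, h2⟩
        rw [← ih2 h1, h2, zero_mul]
      · intro h1
        have h2 : U (k + 1) ≠ 0 := fun h2 => threeTerm_succ_ne_zero _ _ h2 h1
        have h3 := fun h => h2 (ih1.1 h)
        have h4 := ih2 h3
        rw [h1] at h4
        exact ⟨h3, (mul_eq_zero.1 h4).resolve_right h2⟩
    · intro hx
      rw [hiff] at hx
      have hval : nevanlinna (contFrac α (k + 1)) x =
          nevanlinna (α (k + 1)) x - stieltjes (nevanlinnaInv (contFrac α k)) x := by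
        simp only [nevanlinna, contFrac, stieltjes_add]
        ring
      rw [hval, hU (k + 1)]
      -- At a pole of the previous fraction its reciprocal is 0, and so is `U (k + 1)`.
      by_cases h1 : x ∈ (contFrac α k).support
      · rw [stieltjes_nevanlinnaInv_of_pole h1, ih1.1 h1, sub_zero, sub_zero]
      · have h2 := nevanlinna_mul_stieltjes_inv hx h1
        linear_combination (stieltjes (nevanlinnaInv (contFrac α k)) x) * ih2 h1 - U (k + 1) * h2

/-- The largest zero of each fraction lies beyond its poles and is a pole of the next one, so the
rightmost pole only moves outwards. Hence points on the last branch avoid the poles of all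
coefficients. -/
lemma exists_contFrac_pole_ge {α : ℕ → ℝ →₀ ℝ≥0} {x : ℝ} {j k : ℕ} (hjk : j ≤ k)
    (hx : x ∈ (α j).support) : ∃ q ∈ (contFrac α k).support, x ≤ q := by
  induction k with
  | zero =>
    obtain rfl : j = 0 := by omega
    exact ⟨x, hx, le_rfl⟩
  | succ k ih =>
    rcases Nat.le_succ_iff.1 hjk with h | rfl
    · obtain ⟨q, hq, hxq⟩ := ih h
      obtain ⟨s, h1, h2⟩ := exists_nevanlinna_eq_top (contFrac α k) 0
      exact ⟨s, mem_support_add.2 (Or.inr (mem_support_nevanlinnaInv.2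
        ⟨fun h => lt_irrefl _ (h1 s h), h2⟩)), hxq.trans (h1 q hq).le⟩
    · exact ⟨x, mem_support_add.2 (Or.inl hx), le_rfl⟩

lemma exists_contFrac_pole_le {α : ℕ → ℝ →₀ ℝ≥0} {x : ℝ} {j k : ℕ} (hjk : j ≤ k)
    (hx : x ∈ (α j).support) : ∃ q ∈ (contFrac α k).support, q ≤ x := by
  induction k with
  | zero =>
    obtain rfl : j = 0 := by omega
    exact ⟨x, hx, le_rfl⟩
  | succ k ih =>
    rcases Nat.le_succ_iff.1 hjk with h | rfl
    · obtain ⟨q, hq, hxq⟩ := ih h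
      obtain ⟨s, h1, h2⟩ := exists_nevanlinna_eq_bot (contFrac α k) 0
      exact ⟨s, mem_support_add.2 (Or.inr (mem_support_nevanlinnaInv.2
        ⟨fun h => lt_irrefl _ (h1 s h), h2⟩)), (h1 q hq).le.trans hxq⟩
    · exact ⟨x, mem_support_add.2 (Or.inl hx), le_rfl⟩

/-- Every Nevanlinna function has a zero, so each step of the fraction after the first creates a
pole. This is what singles out `P_2` and `P_3`. -/
lemma eq_zero_of_contFrac_eq_zero {α : ℕ → ℝ →₀ ℝ≥0} {k : ℕ} (h : contFrac α k = 0) :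
    k = 0 ∧ α 0 = 0 := by
  rcases k with _ | k
  · exact ⟨rfl, h⟩
  · obtain ⟨s, h1, h2⟩ := exists_nevanlinna_eq_top (contFrac α k) 0
    have : s ∈ (contFrac α (k + 1)).support := mem_support_add.2 (Or.inr
      (mem_support_nevanlinnaInv.2 ⟨fun h => lt_irrefl _ (h1 s h), h2⟩))
    rw [h] at this
    simp at this

/-! ### Two close solutions of the closing conditions -/

lemma exists_close_pair_even {α : ℕ → ℝ →₀ ℝ≥0} {k : ℕ} (hk : contFrac α k ≠ 0) {P : ℝ → Prop}
    (hP : ∀ x, (∀ j ≤ k, x ∉ (α j).support) → ∀ ε : ℝ, ε * ε = 1 →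
      threeTerm (fun j => nevanlinna (α j) x) (k + 2) =
        ε * threeTerm (fun j => nevanlinna (α j) x) (k + 1) → P x) :
    ∃ x, P x ∧ ∃ y, P y ∧ x ≠ y ∧ |x - y| ≤ 1 := by
  set F := contFrac α k
  have hgood : ∀ x, ((∀ p ∈ F.support, p < x) ∨ (∀ p ∈ F.support, x < p)) → ∀ ε, ε * ε = 1 →
      nevanlinna F x = ε → P x := by
    intro x hx ε hε hFx
    have h1 : ∀ j ≤ k, x ∉ (α j).support := fun j hj hxj => by
      rcases hx with hx | hx
      · obtain ⟨q, hq, hxq⟩ := exists_contFrac_pole_ge hj hxj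
        exact absurd (hx q hq) (not_lt.2 hxq)
      · obtain ⟨q, hq, hxq⟩ := exists_contFrac_pole_le hj hxj
        exact absurd (hx q hq) (not_lt.2 hxq)
    refine hP x h1 ε hε ?_
    rw [← (contFrac_threeTerm h1).2 fun h => by rcases hx with hx | hx <;> exact lt_irrefl _ (hx x h)]
    congr 1
  obtain ⟨a, ha, fa⟩ := exists_nevanlinna_eq_top F 1
  obtain ⟨b, hb, fb⟩ := exists_nevanlinna_eq_top F (-1)
  obtain ⟨a', ha', fa'⟩ := exists_nevanlinna_eq_bot F 1
  obtain ⟨b', hb', fb'⟩ := exists_nevanlinna_eq_bot F (-1)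
  have hab : b < a := by
    by_contra! h
    have := nevanlinna_sub_ge h fun p hp hp' => absurd (ha p hp) (not_lt.2 hp'.1)
    linarith
  have hab' : b' < a' := by
    by_contra! h
    have := nevanlinna_sub_ge h fun p hp hp' => absurd (hb' p hp) (not_lt.2 hp'.2)
    linarith
  rcases nevanlinna_outer_gap hk hb ha' fa fb fa' fb' with h | h
  · refine ⟨a, hgood a (Or.inl ha) 1 (by norm_num) fa, b,
      hgood b (Or.inl hb) (-1) (by norm_num) fb, hab.ne', ?_⟩
    rwa [abs_of_pos (by linarith)]
  · refine ⟨a', hgood a' (Or.inr ha') 1 (by norm_num) fa', b',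
      hgood b' (Or.inr hb') (-1) (by norm_num) fb', hab'.ne', ?_⟩
    rwa [abs_of_pos (by linarith)]

/-- `P` will be membership in the eigenvalue support; `hP₁` stands for odd extensions, `hP₂` for
even ones. The pair consists of the largest zero of the fraction and a zero of `α (k + 1) - 2 / f_k`
beside it. -/
lemma exists_close_pair_odd {α : ℕ → ℝ →₀ ℝ≥0} {k : ℕ}
    (hk : ¬(contFrac α k = 0 ∧ α (k + 1) = 0)) {P : ℝ → Prop}
    (hP₁ : ∀ x, (∀ j ≤ k, x ∉ (α j).support) →
      threeTerm (fun j => nevanlinna (α j) x) (k + 2) = 0 → P x)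
    (hP₂ : ∀ x, (∀ j ≤ k + 1, x ∉ (α j).support) →
      nevanlinna (α (k + 1)) x * threeTerm (fun j => nevanlinna (α j) x) (k + 2) =
        2 * threeTerm (fun j => nevanlinna (α j) x) (k + 1) → P x)
    (hP : ∀ x, P x → x ∉ (α (k + 1)).support) :
    ∃ x, P x ∧ ∃ y, P y ∧ x ≠ y ∧ |x - y| < √2 := by
  set F := contFrac α k
  set D := α (k + 1)
  set G := nevanlinnaInv F
  set S := D + (G + G)
  have hmS : ∀ x, x ∈ S.support ↔ x ∈ D.support ∨ x ∈ G.support := fun x => by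
    rw [mem_support_add, mem_support_add, or_self]
  have hS : ∀ x, nevanlinna S x = nevanlinna D x - 2 * stieltjes G x := fun x => by
    simp only [nevanlinna, S, stieltjes_add]
    ring
  have hr : 0 < √2 := by positivity
  have hr2 : √2 * √2 = 2 := Real.mul_self_sqrt (by norm_num)
  obtain ⟨z, hz, fz⟩ := exists_nevanlinna_eq_top F 0
  have hzF : z ∉ F.support := fun h => lt_irrefl _ (hz z h)
  have hzG : z ∈ G.support := mem_support_nevanlinnaInv.2 ⟨hzF, fz⟩
  have hzmax : ∀ x ∈ G.support, x ≤ z := fun x hx => by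
    by_contra! h
    have h1 := nevanlinna_sub_ge h.le fun p hp hp' => absurd (hz p hp) (not_lt.2 hp'.1)
    have h2 := (mem_support_nevanlinnaInv.1 hx).2
    linarith
  have hPz : P z := by
    have h1 : ∀ j ≤ k, z ∉ (α j).support := fun j hj hzj => by
      obtain ⟨q, hq, hzq⟩ := exists_contFrac_pole_ge hj hzj
      exact absurd (hz q hq) (not_lt.2 hzq)
    refine hP₁ z h1 ?_
    rw [← (contFrac_threeTerm h1).2 hzF, fz, zero_mul]
  have hzD := hP z hPz
  have hzS : z ∈ S.support := (hmS z).2 (Or.inr hzG)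
  have hPs : ∀ s, s ∉ S.support → nevanlinna S s = 0 → (∀ j ≤ k, s ∉ (α j).support) → P s := by
    intro s hs h0 hα
    rw [hmS, not_or] at hs
    refine hP₂ s (fun j hj => ?_) ?_
    · rcases Nat.le_succ_iff.1 hj with h | rfl
      · exact hα j h
      · exact hs.1
    · have h1 := contFrac_threeTerm hα
      have h2 : nevanlinna D s = 2 * stieltjes G s := by
        rw [hS] at h0
        linarith
      rw [h2]
      by_cases hsF : s ∈ F.support
      · rw [h1.1.1 hsF, stieltjes_nevanlinnaInv_of_pole hsF]
        ring
      · rw [← h1.2 hsF]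
        linear_combination 2 * threeTerm (fun j => nevanlinna (α j) s) (k + 1) *
          nevanlinna_mul_stieltjes_inv hs.2 hsF
  by_contra! hcon
  have hfar : ∀ s, P s → s ≠ z → √2 ≤ |z - s| := fun s hs hsz => hcon z hPz s hs hsz.symm
  -- no zero of `S` in the open interval of length `√2` to the right of `z`
  have hright : ¬((∃ q ∈ S.support, z < q ∧ q ≤ z + √2) ∨ 0 < nevanlinna S (z + √2)) := by
    intro h
    obtain ⟨s, h1, h2, h3, h4⟩ := exists_nevanlinna_eq_right hzS (by linarith) h
    have := hfar s (hPs s (fun hs => h4 s hs ⟨h1, le_rfl⟩) h3 fun j hj hsj => by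
      obtain ⟨q, hq, hsq⟩ := exists_contFrac_pole_ge hj hsj
      linarith [hz q hq]) h1.ne'
    rw [abs_sub_comm, abs_of_pos (by linarith)] at this
    linarith
  rw [not_or, not_lt] at hright
  obtain ⟨hright1, hright2⟩ := hright
  push Not at hright1
  have hDright : ∀ p ∈ D.support, ¬(z ≤ p ∧ p ≤ z + √2) := fun p hp ⟨h1, h2⟩ => by
    rcases h1.eq_or_lt with rfl | h1
    · exact hzD hp
    · linarith [hright1 p ((hmS p).2 (Or.inl hp)) h1]
  have hFX : √2 ≤ nevanlinna F (z + √2) := by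
    have := nevanlinna_sub_ge (F := F) (x := z) (y := z + √2) (by linarith)
      fun p hp hp' => absurd (hz p hp) (not_lt.2 hp'.1)
    linarith
  -- The sign of `S` at `z + √2` says that `D ≤ 2 / F` there, and `F` is positive.
  have hprod : nevanlinna D (z + √2) * nevanlinna F (z + √2) ≤ 2 := by
    have h1 : nevanlinna F (z + √2) * stieltjes G (z + √2) = 1 :=
      nevanlinna_mul_stieltjes_inv (fun h => by linarith [hzmax _ h]) fun h => by linarith [hz _ h]
    rw [hS] at hright2
    nlinarith
  have hDX : nevanlinna D (z + √2) ≤ √2 := by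
    by_contra! h
    nlinarith
  -- `D` has no pole up to `z + √2` once `S` has none up to `z`
  have hDS : ∀ s < z, (∀ q ∈ S.support, ¬(s ≤ q ∧ q < z)) →
      ∀ p ∈ D.support, ¬(s ≤ p ∧ p ≤ z + √2) := fun s hs h p hp ⟨h1, h2⟩ => by
    rcases lt_or_ge p z with h3 | h3
    · exact h p ((hmS p).2 (Or.inl hp)) ⟨h1, h3⟩
    · exact hDright p hp ⟨h3, h2⟩
  -- The reciprocal of `F` decreases on a pole-free interval from `s` to `q` and vanishes at `q`.
  have hGS : ∀ s < z, (∀ q ∈ S.support, ¬(s ≤ q ∧ q < z)) → ∀ q ∈ F.support, s ≤ q →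
      0 ≤ stieltjes G s := fun s hs h q hq hsq => by
    rw [← stieltjes_nevanlinnaInv_of_pole hq]
    exact stieltjes_anti hsq fun p hp hp' =>
      h p ((hmS p).2 (Or.inr hp)) ⟨hp'.1, hp'.2.trans_lt (hz q hq)⟩
  by_cases hleft : (∃ q ∈ S.support, z - √2 ≤ q ∧ q < z) ∨ nevanlinna S (z - √2) < 0
  · obtain ⟨s, h1, h2, h3, h4⟩ := exists_nevanlinna_eq_left hzS (by linarith) hleft
    by_cases hα : ∀ j ≤ k, s ∉ (α j).support
    · have := hfar s (hPs s (fun hs => h4 s hs ⟨le_rfl, h2⟩) h3 hα) h2.ne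
      rw [abs_of_pos (by linarith)] at this
      linarith
    -- Here `s` may fail to give an eigenvector. But then `D` is nonnegative at `s`, and slope one
    -- carries it above `√2` at `z + √2`.
    · push Not at hα
      obtain ⟨j, hj, hsj⟩ := hα
      obtain ⟨q, hq, hsq⟩ := exists_contFrac_pole_ge hj hsj
      have h5 := hGS s h2 h4 q hq hsq
      have h6 := nevanlinna_sub_ge (by linarith) (hDS s h2 h4)
      rw [hS] at h3
      linarith
  · rw [not_or, not_lt] at hleft
    obtain ⟨hleft1, hleft2⟩ := hleft
    have h4 : ∀ q ∈ S.support, ¬(z - √2 ≤ q ∧ q < z) := fun q hq hq' => hleft1 ⟨q, hq, hq'⟩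
    have h5 := hDS (z - √2) (by linarith) h4
    have h6 := nevanlinna_sub_ge (by linarith) h5
    rw [hS] at hleft2
    by_cases hq : ∃ q ∈ F.support, z - √2 ≤ q
    · obtain ⟨q, hq, hqz⟩ := hq
      have := hGS (z - √2) (by linarith) h4 q hq hqz
      linarith
    · push Not at hq
      have hFno : ∀ p ∈ F.support, ¬(z - √2 ≤ p ∧ p ≤ z) := fun p hp hp' => by
        linarith [hq p hp]
      have h7 := nevanlinna_sub_ge (by linarith) hFno
      have h8 : nevanlinna F (z - √2) * stieltjes G (z - √2) = 1 :=
        nevanlinna_mul_stieltjes_inv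
          (fun h => h4 _ ((hmS _).2 (Or.inr h)) ⟨le_rfl, by linarith⟩)
          fun h => by linarith [hq _ h]
      have h9 : -√2 ≤ 2 * stieltjes G (z - √2) := by
        by_contra! h
        nlinarith
      -- All estimates so far are consistent only with equality; a pole of `D` or of `F` makes one
      -- slope bound strict.
      by_cases hD : D = 0
      · have hF : F ≠ 0 := fun hF => hk ⟨hF, hD⟩
        have h10 := nevanlinna_sub_gt hF (x := z) (y := z + √2) (by linarith)
          fun p hp hp' => absurd (hz p hp) (not_lt.2 hp'.1)
        nlinarith
      · have := nevanlinna_sub_gt hD (by linarith) h5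
        linarith

/-! ### Gluing eigenvectors of the rooted product -/

/-- Symmetric and antisymmetric extensions of a solution of the three-term recurrence. -/
lemma recurrence_of_symm {n h : ℕ} {a U u : ℕ → ℝ} {ε : ℝ}
    (hU : ∀ i, U (i + 2) = a i * U (i + 1) - U i)
    (hu : ∀ j ≤ h + 1, u j = U j) (hsymm : ∀ j ≤ n + 1, u (n + 1 - j) = ε * u j)
    {i : ℕ} (hi : i < n) (hih : i < h ∨ n - 1 - i < h)
    (ha : a i = a (n - 1 - i)) :
    a i * u (i + 1) = u i + u (i + 2) := by
  have key : ∀ i < h, a i * u (i + 1) = u i + u (i + 2) := fun i hi => by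
    rw [hu _ (by omega), hu _ (by omega), hu _ (by omega), hU]
    ring
  rcases hih with hih | hih
  · exact key i hih
  · have h1 := hsymm (n - 1 - i) (by omega)
    have h2 := hsymm (n - 1 - i + 1) (by omega)
    have h3 := hsymm (n - 1 - i + 2) (by omega)
    rw [show n + 1 - (n - 1 - i) = i + 2 by omega] at h1
    rw [show n + 1 - (n - 1 - i + 1) = i + 1 by omega] at h2
    rw [show n + 1 - (n - 1 - i + 2) = i by omega] at h3
    rw [h1, h2, h3, ha]
    linear_combination ε * key _ hih

namespace SimpleGraph

lemma rootedProduct_adj_same {ι : Type*} (H : SimpleGraph ι) {V : ι → Type*}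
    (G : ∀ i, SimpleGraph (V i)) (r : ∀ i, V i) (i : ι) (a b : V i) :
    (H.rootedProduct G r).Adj ⟨i, a⟩ ⟨i, b⟩ ↔ (G i).Adj a b := by
  constructor
  · rintro (⟨j, c, d, h, hx, hy⟩ | ⟨j, l, h, hx, hy⟩)
    · cases hx
      cases hy
      exact h
    · cases hx
      cases hy
      exact absurd h (H.irrefl)
  · exact fun h => Or.inl ⟨i, a, b, h, rfl, rfl⟩

lemma rootedProduct_adj_ne {ι : Type*} (H : SimpleGraph ι) {V : ι → Type*}
    (G : ∀ i, SimpleGraph (V i)) (r : ∀ i, V i) {i j : ι} (hij : i ≠ j) (a : V i) (b : V j) :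
    (H.rootedProduct G r).Adj ⟨i, a⟩ ⟨j, b⟩ ↔ H.Adj i j ∧ a = r i ∧ b = r j := by
  constructor
  · rintro (⟨j, c, d, h, hx, hy⟩ | ⟨j, l, h, hx, hy⟩)
    · cases hx
      cases hy
      exact absurd rfl hij
    · cases hx
      cases hy
      exact ⟨h, rfl, rfl⟩
  · rintro ⟨h, rfl, rfl⟩
    exact Or.inr ⟨i, j, h, rfl, rfl⟩

open Classical in
/-- Gluing local solutions at the roots gives an eigenvector of the rooted product. -/
lemma rootedProduct_mulVec {ι : Type*} [Fintype ι] (H : SimpleGraph ι) {V : ι → Type*}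
    [∀ i, Fintype (V i)] (G : ∀ i, SimpleGraph (V i)) (r : ∀ i, V i) (x : ℝ)
    (w : ∀ i, V i → ℝ) (hw : ∀ i, (G i).adjMatrix ℝ *ᵥ w i =
      x • w i - Pi.single (r i) (∑ j, if H.Adj i j then w j (r j) else 0)) :
    (H.rootedProduct G r).adjMatrix ℝ *ᵥ (fun v => w v.1 v.2) = x • fun v => w v.1 v.2 := by
  funext ⟨i, a⟩
  have h1 : ∀ j, (∑ b : V j, (H.rootedProduct G r).adjMatrix ℝ ⟨i, a⟩ ⟨j, b⟩ * w j b) =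
      (if j = i then ((G i).adjMatrix ℝ *ᵥ w i) a else 0) +
        if a = r i then (if H.Adj i j then w j (r j) else 0) else 0 := by
    intro j
    by_cases hij : i = j
    · subst hij
      simp [Matrix.mulVec, dotProduct, adjMatrix_apply, rootedProduct_adj_same]
    · rw [if_neg (Ne.symm hij), zero_add]
      simp only [adjMatrix_apply, rootedProduct_adj_ne H G r hij, ite_mul, one_mul, zero_mul]
      by_cases ha : a = r i <;> by_cases hH : H.Adj i j <;> simp [ha, hH]
  rw [Matrix.mulVec, dotProduct, Fintype.sum_sigma]
  simp only [h1]
  rw [Finset.sum_add_distrib, Finset.sum_ite_eq' Finset.univ i, if_pos (Finset.mem_univ _), hw]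
  by_cases ha : a = r i
  · subst ha
    simp
  · simp [ha]

open Classical in
lemma sum_pathGraph_adj {n : ℕ} {u : ℕ → ℝ} (h0 : u 0 = 0) (hn : u (n + 1) = 0) (i : Fin n) :
    (∑ j : Fin n, if (pathGraph n).Adj i j then u (j + 1) else 0) = u i + u (i + 2) := by
  have h1 : ∀ j : Fin n, (if (pathGraph n).Adj i j then u (j + 1) else 0) =
      (if (j : ℕ) + 1 = i then u (j + 1) else 0) + if (j : ℕ) = i + 1 then u (j + 1) else 0 := by
    intro j
    rw [pathGraph_adj]
    by_cases h1 : (j : ℕ) + 1 = i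
    · rw [if_pos (Or.inr h1), if_pos h1, if_neg (by omega), add_zero]
    · by_cases h2 : (j : ℕ) = i + 1
      · rw [if_pos (Or.inl h2.symm), if_neg h1, if_pos h2, zero_add]
      · rw [if_neg (by omega), if_neg h1, if_neg h2, zero_add]
  simp only [h1]
  rw [Finset.sum_add_distrib]
  congr 1
  · rcases Nat.eq_zero_or_pos (i : ℕ) with h | h
    · rw [h, h0]
      exact Finset.sum_eq_zero fun j _ => if_neg (by omega)
    · rw [Finset.sum_eq_single ⟨i - 1, by omega⟩]
      · simp only
        rw [if_pos (by omega)]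
        congr 1
        omega
      · intro j _ hj
        exact if_neg fun h => hj (Fin.ext (by simp only; omega))
      · simp
  · rcases Nat.lt_or_ge (i + 1) n with h | h
    · rw [Finset.sum_eq_single ⟨i + 1, h⟩]
      · simp
      · intro j _ hj
        exact if_neg fun h => hj (Fin.ext h)
      · simp
    · rw [show (i : ℕ) + 2 = n + 1 by omega, hn]
      exact Finset.sum_eq_zero fun j _ => if_neg (by omega)

-- The entry at the root `i` is `u (i + 1)`; the shift lets `u 0 = 0` and `u (n + 1) = 0` act as
-- boundary conditions at the ends of the path.
open Classical in
lemma mem_eigenvalueSupport_rootedProduct_pathGraph {n : ℕ} (hn : 0 < n) {V : Fin n → Type*}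
    [∀ i, Fintype (V i)] (G : ∀ i, SimpleGraph (V i)) (r : ∀ i, V i) (x : ℝ) (u : ℕ → ℝ)
    (h0 : u 0 = 0) (h1 : u 1 ≠ 0) (hun : u (n + 1) = 0)
    (hw : ∀ i : Fin n, ∃ w : V i → ℝ, w (r i) = u (i + 1) ∧
      (G i).adjMatrix ℝ *ᵥ w = x • w - Pi.single (r i) (u i + u (i + 2))) :
    x ∈ ((pathGraph n).rootedProduct G r).eigenvalueSupport ⟨⟨0, hn⟩, r ⟨0, hn⟩⟩ := by
  choose w hw1 hw2 using hw
  refine ⟨fun v => w v.1 v.2, ?_, ?_⟩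
  · refine Eq.trans ?_ (rootedProduct_mulVec (pathGraph n) G r x w fun i => ?_)
    · congr!
    · simp only [hw1]
      rw [sum_pathGraph_adj h0 hun, hw2]
  · show w ⟨0, hn⟩ (r ⟨0, hn⟩) ≠ 0
    rw [hw1]
    exact h1

/-- If the roots are isolated in the `G i`, then the path is a component of the product. -/
lemma nonempty_component_iso_pathGraph {n : ℕ} {V : Fin n → Type*}
    (G : ∀ i, SimpleGraph (V i)) (r : ∀ i, V i) (hG : ∀ i j, ¬(G i).Adj (r i) j) (i₀ : Fin n) :
    Nonempty ((((pathGraph n).rootedProduct G r).connectedComponentMk ⟨i₀, r i₀⟩).toSimpleGraph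
      ≃g pathGraph n) := by
  set P := (pathGraph n).rootedProduct G r
  have hadj : ∀ i j, P.Adj ⟨i, r i⟩ ⟨j, r j⟩ ↔ (pathGraph n).Adj i j := by
    intro i j
    by_cases hij : i = j
    · subst hij
      simp
    · rw [rootedProduct_adj_ne _ _ _ hij]
      simp
  let f : pathGraph n →g P := ⟨fun i => ⟨i, r i⟩, fun {i j} h => (hadj i j).2 h⟩
  have hmem : ∀ i, (⟨i, r i⟩ : Σ i, V i) ∈ P.connectedComponentMk ⟨i₀, r i₀⟩ := fun i =>
    ConnectedComponent.eq.2 ((pathGraph_preconnected n i i₀).map f)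
  have hstep : ∀ v w : Σ i, V i, P.Adj v w → v.2 = r v.1 → w.2 = r w.1 := by
    rintro v w (⟨i, a, b, h, rfl, rfl⟩ | ⟨i, j, h, rfl, rfl⟩) hv
    · simp only at hv
      subst hv
      exact absurd h (hG i b)
    · rfl
  have hwalk : ∀ v w : Σ i, V i, P.Walk v w → v.2 = r v.1 → w.2 = r w.1 := by
    intro v w p
    induction p with
    | nil => exact id
    | cons h _ ih => exact fun hv => ih (hstep _ _ h hv)
  refine ⟨RelIso.symm ⟨Equiv.ofBijective (fun i => ⟨⟨i, r i⟩, hmem i⟩) ⟨?_, ?_⟩, ?_⟩⟩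
  · intro i j hij
    exact congrArg (fun v => v.1.1) hij
  · rintro ⟨⟨i, a⟩, hv⟩
    obtain ⟨p⟩ := ConnectedComponent.eq.1 hv
    have : a = r i := hwalk _ _ p.reverse rfl
    subst this
    exact ⟨i, rfl⟩
  · intro i j
    exact hadj i j

end SimpleGraph

/-! ### The two parities -/

theorem theorem1 (n : ℕ) (hn : 2 ≤ n) (V : Fin n → Type*) [∀ i, Fintype (V i)]
    (G : ∀ i, SimpleGraph (V i)) (r : ∀ i, V i)
    (P : SimpleGraph (Σ i, V i))
    (hP : P = (SimpleGraph.pathGraph n).rootedProduct G r)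
    (one : Σ i, V i) (hone : one = ⟨⟨0, by omega⟩, r ⟨0, by omega⟩⟩)
    (hP₂ : IsEmpty ((P.connectedComponentMk one).toSimpleGraph ≃g SimpleGraph.pathGraph 2))
    (hP₃ : IsEmpty ((P.connectedComponentMk one).toSimpleGraph ≃g SimpleGraph.pathGraph 3))
    (hsymm : ∀ i, (G i).rootFunction (r i) = (G i.rev).rootFunction (r i.rev))
    (hpole : ∀ θ : ℝ, (P.rootFunction one).IsZeroAt θ →
      ∀ i, ¬ ((G i).rootFunction (r i)).IsPoleAt θ) :
    ∃ lam ∈ P.eigenvalueSupport one, ∃ mu ∈ P.eigenvalueSupport one, lam ≠ mu ∧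
      (Odd n → |lam - mu| < √2) ∧ (Even n → |lam - mu| ≤ 1) := by
  classical
  subst hP hone
  choose φ hφpole hφev hφsol _ hφzero using fun i =>
    (G i).exists_rootFunction_eq_nevanlinna (r i)
  set α : ℕ → ℝ →₀ ℝ≥0 := fun k => if h : k < n then φ ⟨k, h⟩ else 0
  have hα : ∀ i : Fin n, α i = φ i := fun i => dif_pos i.2
  have hsupp : ∀ i, (φ i).support = (φ i.rev).support := fun i => by
    ext x
    rw [← hφpole, ← hφpole, hsymm i]
  have hval : ∀ i x, x ∉ (φ i).support → nevanlinna (φ i) x = nevanlinna (φ i.rev) x :=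
    fun i x hx => by
      rw [← hφev i x hx, ← hφev i.rev x (hsupp i ▸ hx), hsymm i]
  have hrev : ∀ i (hi : i < n), (⟨i, hi⟩ : Fin n).rev = ⟨n - 1 - i, by omega⟩ := fun i hi =>
    Fin.ext (by simp only [Fin.val_rev]; omega)
  have hαsupp : ∀ i < n, (α i).support = (α (n - 1 - i)).support := fun i hi => by
    have := hsupp ⟨i, hi⟩
    rw [hrev] at this
    rwa [← hα, ← hα] at this
  have hαval : ∀ x, ∀ i < n, x ∉ (α i).support →
      nevanlinna (α i) x = nevanlinna (α (n - 1 - i)) x := fun x i hi hx => by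
    have := hval ⟨i, hi⟩ x (by rwa [← hα])
    rw [hrev] at this
    rwa [← hα, ← hα] at this
  have hiso : (∀ i < n, α i = 0) → Nonempty
      ((((SimpleGraph.pathGraph n).rootedProduct G r).connectedComponentMk
        ⟨⟨0, by omega⟩, r ⟨0, by omega⟩⟩).toSimpleGraph ≃g SimpleGraph.pathGraph n) := fun h =>
    SimpleGraph.nonempty_component_iso_pathGraph G r
      (fun i => hφzero i (by rw [← hα, h i i.2])) _
  have hαzero : ∀ i < n, α i = 0 → α (n - 1 - i) = 0 := fun i hi h => by
    have := hαsupp i hi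
    rw [h, Finsupp.support_zero] at this
    exact Finsupp.support_eq_empty.1 this.symm
  have hlocal : ∀ (x : ℝ) (u : ℕ → ℝ) (i : Fin n), x ∉ (α i).support →
      nevanlinna (α i) x * u (i + 1) = u i + u (i + 2) →
      ∃ w : V i → ℝ, w (r i) = u (i + 1) ∧
        (G i).adjMatrix ℝ *ᵥ w = x • w - Pi.single (r i) (u i + u (i + 2)) := by
    intro x u i hx hu
    rw [hα] at hx hu
    obtain ⟨y, hy, hy'⟩ := hφsol i x hx
    refine ⟨u (i + 1) • y, by simp [hy], ?_⟩
    rw [Matrix.mulVec_smul, hy', smul_sub, smul_comm, ← hu, ← Pi.single_smul, smul_eq_mul,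
      mul_comm]
  rcases Nat.even_or_odd' n with ⟨m, rfl | rfl⟩
  · obtain ⟨k, rfl⟩ : ∃ k, m = k + 1 := ⟨m - 1, by omega⟩
    have hk : contFrac α k ≠ 0 := fun h => by
      obtain ⟨rfl, h0⟩ := eq_zero_of_contFrac_eq_zero h
      refine (not_isEmpty_iff.2 (hiso fun i hi => ?_)) hP₂
      rcases (by omega : i = 0 ∨ i = 1) with rfl | rfl
      · exact h0
      · exact hαzero 0 (by norm_num) h0
    obtain ⟨x, hx, y, hy, hxy, hlt⟩ := exists_close_pair_even hk
      (P := fun x => x ∈ ((SimpleGraph.pathGraph (2 * (k + 1))).rootedProduct G r).eigenvalueSupport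
        ⟨⟨0, by omega⟩, r ⟨0, by omega⟩⟩) (by
      intro x hx ε hε hU
      set U := threeTerm fun j => nevanlinna (α j) x
      have hx' : ∀ i < 2 * (k + 1), x ∉ (α i).support := fun i hi => by
        rcases Nat.lt_or_ge k i with h | h
        · rw [hαsupp i hi]
          exact hx _ (by omega)
        · exact hx i h
      -- The extension of parity `ε` about the central edge; the closing condition makes it agree
      -- with `U` one step past the middle.
      set u : ℕ → ℝ := fun j => if j ≤ k + 1 then U j else ε * U (2 * (k + 1) + 1 - j)
      have hu : ∀ j ≤ k + 1 + 1, u j = U j := fun j hj => by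
        by_cases h : j ≤ k + 1
        · exact if_pos h
        · obtain rfl : j = k + 2 := by omega
          refine (if_neg h).trans ?_
          rw [hU, show 2 * (k + 1) + 1 - (k + 2) = k + 1 by omega]
      have husymm : ∀ j ≤ 2 * (k + 1) + 1, u (2 * (k + 1) + 1 - j) = ε * u j := fun j hj => by
        by_cases h : j ≤ k + 1
        · simp only [u]
          rw [if_neg (by omega), if_pos h, Nat.sub_sub_self hj]
        · simp only [u]
          rw [if_pos (by omega), if_neg h, ← mul_assoc, hε, one_mul]
      have hu0 : u 0 = 0 := hu 0 (by omega)
      have hu1 : u 1 = 1 := hu 1 (by omega)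
      refine SimpleGraph.mem_eigenvalueSupport_rootedProduct_pathGraph (by omega) G r x u hu0
        (by rw [hu1]; exact one_ne_zero) ?_ fun i => hlocal x u i (hx' i i.2) ?_
      · have := husymm 0 (by omega)
        rwa [hu0, mul_zero] at this
      · exact recurrence_of_symm (a := fun j => nevanlinna (α j) x)
          (threeTerm_succ_succ _) hu husymm i.2 (by omega) (hαval x i i.2 (hx' i i.2)))
    exact ⟨x, hx, y, hy, hxy, fun h => absurd h (by simp), fun _ => hlt⟩
  · obtain ⟨k, rfl⟩ : ∃ k, m = k + 1 := ⟨m - 1, by omega⟩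
    have hk : ¬(contFrac α k = 0 ∧ α (k + 1) = 0) := fun ⟨h, h1⟩ => by
      obtain ⟨rfl, h0⟩ := eq_zero_of_contFrac_eq_zero h
      refine (not_isEmpty_iff.2 (hiso fun i hi => ?_)) hP₃
      rcases (by omega : i = 0 ∨ i = 1 ∨ i = 2) with rfl | rfl | rfl
      · exact h0
      · exact h1
      · exact hαzero 0 (by norm_num) h0
    have hmem : ∀ (x ε : ℝ), ε * ε = 1 → (∀ j ≤ k, x ∉ (α j).support) →
        ε * threeTerm (fun j => nevanlinna (α j) x) (k + 2) =
          threeTerm (fun j => nevanlinna (α j) x) (k + 2) →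
        ((threeTerm (fun j => nevanlinna (α j) x) (k + 2) = 0 ∧ ε = -1) ∨
          (x ∉ (α (k + 1)).support ∧ nevanlinna (α (k + 1)) x *
            threeTerm (fun j => nevanlinna (α j) x) (k + 2) =
            (1 + ε) * threeTerm (fun j => nevanlinna (α j) x) (k + 1))) →
        x ∈ ((SimpleGraph.pathGraph (2 * (k + 1) + 1)).rootedProduct G r).eigenvalueSupport
          ⟨⟨0, by omega⟩, r ⟨0, by omega⟩⟩ := by
      intro x ε hε hx hεU hmid
      set U := threeTerm fun j => nevanlinna (α j) x
      have hx' : ∀ i < 2 * (k + 1) + 1, i ≠ k + 1 → x ∉ (α i).support := fun i hi hik => by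
        rcases Nat.lt_or_ge k i with h | h
        · rw [hαsupp i hi]
          exact hx _ (by omega)
        · exact hx i h
      set u : ℕ → ℝ := fun j => if j ≤ k + 2 then U j else ε * U (2 * (k + 1) + 1 + 1 - j)
      have hu : ∀ j ≤ k + 1 + 1, u j = U j := fun j hj => if_pos hj
      have husymm : ∀ j ≤ 2 * (k + 1) + 1 + 1, u (2 * (k + 1) + 1 + 1 - j) = ε * u j := by
        intro j hj
        rcases Nat.lt_trichotomy j (k + 2) with h | rfl | h
        · simp only [u]
          rw [if_neg (by omega), if_pos (by omega), Nat.sub_sub_self hj]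
        · rw [show 2 * (k + 1) + 1 + 1 - (k + 2) = k + 2 by omega, hu _ le_rfl, hεU]
        · simp only [u]
          rw [if_pos (by omega), if_neg (by omega), ← mul_assoc, hε, one_mul]
      have hu0 : u 0 = 0 := hu 0 (by omega)
      have hu1 : u 1 = 1 := hu 1 (by omega)
      have hu3 : u (k + 1 + 2) = ε * U (k + 1) := by
        have := husymm (k + 1) (by omega)
        rwa [hu (k + 1) (by omega),
          show 2 * (k + 1) + 1 + 1 - (k + 1) = k + 1 + 2 by omega] at this
      refine SimpleGraph.mem_eigenvalueSupport_rootedProduct_pathGraph (by omega) G r x u hu0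
        (by rw [hu1]; exact one_ne_zero) ?_ fun i => ?_
      · have := husymm 0 (by omega)
        rwa [hu0, mul_zero] at this
      · by_cases hi : (i : ℕ) = k + 1
        · rcases hmid with ⟨h1, h2⟩ | ⟨h1, h2⟩
          -- An odd extension is zero on the whole middle graph, so here `x` may be a pole of its
          -- root function.
          · refine ⟨0, ?_, ?_⟩
            · rw [hi, hu _ (by omega), h1]
              rfl
            · rw [hi, hu3, hu _ (by omega), h2]
              simp
          · refine hlocal x u i (by rwa [hi]) ?_
            rw [hi, hu3, hu _ (by omega), hu _ (by omega), h2]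
            ring
        · exact hlocal x u i (hx' i i.2 hi) (recurrence_of_symm
            (a := fun j => nevanlinna (α j) x) (h := k + 1) (threeTerm_succ_succ _) hu husymm
            i.2 (by omega) (hαval x i i.2 (hx' i i.2 hi)))
    obtain ⟨x, hx, y, hy, hxy, hlt⟩ := exists_close_pair_odd hk
      (P := fun x =>
        x ∈ ((SimpleGraph.pathGraph (2 * (k + 1) + 1)).rootedProduct G r).eigenvalueSupport
        ⟨⟨0, by omega⟩, r ⟨0, by omega⟩⟩)
      (fun x hx h0 => hmem x (-1) (by norm_num) hx (by rw [h0]; ring) (Or.inl ⟨h0, rfl⟩))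
      (fun x hx h0 => hmem x 1 (by norm_num) (fun j hj => hx j (by omega)) (one_mul _)
        (Or.inr ⟨hx _ le_rfl, by rw [h0]; ring⟩))
      -- The second hypothesis enters here, for the middle graph: every eigenvalue in the support is
      -- a zero of the root function of the product.
      (fun x hx => by
        have := hpole x (SimpleGraph.isZeroAt_of_mem_eigenvalueSupport _ _ hx) ⟨k + 1, by omega⟩
        rwa [hφpole, ← hα] at this)
    refine ⟨x, hx, y, hy, hxy, fun _ => hlt, fun h => absurd h ?_⟩
    rw [Nat.not_even_iff_odd]
    exact odd_two_mul_add_one _
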